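/- Let $\mathbb A$ be a unital real alternative algebra of finite dimension (the associator $[a,b,c]=(ab)c-a(bc)$ is alternating) with an anti-involution $a\mapsto a^c$ (real linear, $(a^c)^c=a$, $(ab)^c=b^ca^c$). Put $t(x)=x+x^c$, $n(x)=xx^c$, $\mathbb S_{\mathbb A}=\{x: t(x)=0,\ n(x)=1\}$ and $Q_{\mathbb A}=\mathbb R\cup\{x: t(x),n(x)\in\mathbb R,\ 4n(x)>t(x)^2\}$. Let $M$ be a real subspace with $\mathbb R\subsetneq M\subseteq Q_{\mathbb A}$, with a hypercomplex basis $(v_0=1,v_1,\dots,v_m)$, $m\ge 1$: $v_s\in\mathbb S_{\mathbb A}$ and $v_sv_t=-v_tv_s$ for distinct $s,t\in\{1,\dots,m\}$. Complete it to a real basis $(v_0,\dots,v_d)$ of $\mathbb A$; derivatives of $\mathbb A$-valued functions are taken componentwise in this basis. Identify $(x_0,\dots,x_m)\in\mathbb R^{m+1}$ with $x=\sum_{s=0}^m x_sv_s\in M$, and write $\underline x=(x_1,\dots,x_m)$. A $C^1$ function $f:M\to\mathbb A$ is left (right) monogenic if $\sum_{s=0}^m v_s\,\partial_s f=0$ (respectively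 $\sum_{s=0}^m(\partial_s f)v_s=0$) on $M$. Let $\mathcal M^{L}(M,M)$ and $\mathcal M^{R}(M,M)$ be the sets of left and right monogenic functions on $M$ with values in $M$. For a polynomial $f_0:\mathbb R^m\to\mathbb A$ let $$CK[f_0](x)=\sum_{n=0}^{\infty}\frac{(-x_0)^n}{n!}\Big(\Big(\sum_{s=1}^m v_s\partial_s\Big)^{n}f_0\Big)(\underline x).$$ For $\mathrm k=(k_1,\dots,k_m)\in\mathbb N^m$ let $|\mathrm k|=k_1+\dots+k_m$, $\mathrm k!=k_1!\cdots k_m!$, $\underline x^{\mathrm k}=x_1^{k_1}\cdots x_m^{k_m}$, $z_\ell(x)=x_\ell-x_0v_\ell$, and $$\mathcal P_{\mathrm k}(x)=\frac1{|\mathrm k|!}\sum z_{i_1}(x)z_{i_2}(x)\cdots z_{i_{|\mathrm k|}}(x),\qquad \mathcal P_{\mathbf 0}=1,$$ where the sum runs over all words $(i_1,\dots,i_{|\mathrm k|})$ in which each letter $\ell\in\{1,\dots,m\}$ occurs exactly $k_\ell$ times, and all products are formed with one and the same, arbitrarily chosen, placement of parentheses. Then, for every $\mathrm k\in\mathbb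 N^m$ and every placement of parentheses, the series defining $CK[\underline x^{\mathrm k}]$ has only finitely many nonzero terms, $$CK[\underline x^{\mathrm k}]=\mathrm k!\,\mathcal P_{\mathrm k}\in\mathcal M^{L}(M,M)\cap\mathcal M^{R}(M,M),$$ and also $\mathcal P_{\mathrm k}\in\mathcal M^{L}(M,M)\cap\mathcal M^{R}(M,M)$; that is, $\mathcal P_{\mathrm k}$ is $M$-valued and both left and right monogenic. -/

import Mathlib

open scoped BigOperators

noncomputable section

namespace Hypercomplex

/-- A (not necessarily associative) ring is alternative if its associator
`[a,b,c] = (ab)c - a(bc)` is alternating, i.e. vanishes when two arguments coincide. -/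
def IsAlternative (A : Type*) [NonAssocRing A] : Prop :=
  ∀ a b : A, associator a a b = 0 ∧ associator a b b = 0 ∧ associator a b a = 0

section Star

variable {A : Type*} [NonAssocRing A] [StarRing A]

/-- The imaginary units: elements with trace `x + xᶜ = 0` and squared norm `x xᶜ = 1`.
The anti-involution `ᶜ` is `star`. -/
def imagUnits (A : Type*) [NonAssocRing A] [StarRing A] : Set A :=
  {x | x + star x = 0 ∧ x * star x = 1}

/-- The real line `ℝ = ℝ·1` inside the algebra. -/
def realLine (A : Type*) [NonAssocRing A] [Module ℝ A] : Submodule ℝ A :=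
  Submodule.span ℝ {1}

/-- The quadratic cone: the reals, together with all `x` whose trace `t` and squared norm `n`
are real with `4 n > t ^ 2`. -/
def quadraticCone (A : Type*) [NonAssocRing A] [StarRing A] [Module ℝ A] : Set A :=
  (realLine A : Set A) ∪
    {x | ∃ t n : ℝ, x + star x = t • (1 : A) ∧ x * star x = n • (1 : A) ∧ t ^ 2 < 4 * n}

variable [Module ℝ A]

/-- Hypercomplex subspaces: `ℝ ⊊ M ⊆ Q_A`. -/
def IsHypercomplexSubspace (M : Submodule ℝ A) : Prop :=
  realLine A < M ∧ (M : Set A) ⊆ quadraticCone A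

/-- `(v₀, …, v_m)` is a hypercomplex basis of `M`. -/
structure IsHypercomplexBasis (M : Submodule ℝ A) {m : ℕ} (v : Fin (m + 1) → A) : Prop where
  one_le : 1 ≤ m
  linearIndependent : LinearIndependent ℝ v
  span_eq : Submodule.span ℝ (Set.range v) = M
  zero_eq_one : v 0 = 1
  mem_imagUnits : ∀ s : Fin m, v s.succ ∈ imagUnits A
  anticomm : ∀ s t : Fin m, s ≠ t → v s.succ * v t.succ = -(v t.succ * v s.succ)

end Star

section Calculus

variable {A : Type*} [NonAssocRing A] [Module ℝ A] {n m d : ℕ}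

/-- Functions `f = ∑ₜ fₜ bₜ` all of whose real components are `C¹` on `Ω`. -/
def IsC1On (b : Module.Basis (Fin (d + 1)) ℝ A) (Ω : Set (EuclideanSpace ℝ (Fin n)))
    (f : EuclideanSpace ℝ (Fin n) → A) : Prop :=
  ∀ t, ContDiffOn ℝ 1 (fun x => b.coord t (f x)) Ω

/-- The partial derivative `∂f/∂xₛ = ∑ₜ (∂fₜ/∂xₛ) bₜ` of an algebra-valued function
`f = ∑ₜ fₜ bₜ`. -/
def partialDeriv (b : Module.Basis (Fin (d + 1)) ℝ A) (s : Fin n)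
    (f : EuclideanSpace ℝ (Fin n) → A) (x : EuclideanSpace ℝ (Fin n)) : A :=
  ∑ t, lineDeriv ℝ (fun y => b.coord t (f y)) x (EuclideanSpace.single s (1 : ℝ)) • b t

/-- The Cauchy-Riemann operator `∑ₛ vₛ ∂f/∂xₛ` acting from the left. -/
def leftCR (v : Fin (m + 1) → A) (b : Module.Basis (Fin (d + 1)) ℝ A)
    (f : EuclideanSpace ℝ (Fin (m + 1)) → A) (x : EuclideanSpace ℝ (Fin (m + 1))) : A :=
  ∑ s, v s * partialDeriv b s f x

/-- The Cauchy-Riemann operator `∑ₛ (∂f/∂xₛ) vₛ` acting from the right. -/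
def rightCR (v : Fin (m + 1) → A) (b : Module.Basis (Fin (d + 1)) ℝ A)
    (f : EuclideanSpace ℝ (Fin (m + 1)) → A) (x : EuclideanSpace ℝ (Fin (m + 1))) : A :=
  ∑ s, partialDeriv b s f x * v s

/-- Left monogenic functions on a domain `Ω` with values in `N`. Points of the hypercomplex
subspace are identified with their coordinates `(x₀, …, x_m)` in the basis `v`. -/
def leftMonogenic (v : Fin (m + 1) → A) (b : Module.Basis (Fin (d + 1)) ℝ A)
    (Ω : Set (EuclideanSpace ℝ (Fin (m + 1)))) (N : Submodule ℝ A) :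
    Set (EuclideanSpace ℝ (Fin (m + 1)) → A) :=
  {f | (∀ x ∈ Ω, f x ∈ N) ∧ IsC1On b Ω f ∧ ∀ x ∈ Ω, leftCR v b f x = 0}

/-- Right monogenic functions on a domain `Ω` with values in `N`. -/
def rightMonogenic (v : Fin (m + 1) → A) (b : Module.Basis (Fin (d + 1)) ℝ A)
    (Ω : Set (EuclideanSpace ℝ (Fin (m + 1)))) (N : Submodule ℝ A) :
    Set (EuclideanSpace ℝ (Fin (m + 1)) → A) :=
  {f | (∀ x ∈ Ω, f x ∈ N) ∧ IsC1On b Ω f ∧ ∀ x ∈ Ω, rightCR v b f x = 0}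

/-- The operator `∑_{s=1}^m vₛ ∂/∂xₛ` on functions of `(x₁, …, x_m)`. -/
def vectorCR (v : Fin (m + 1) → A) (b : Module.Basis (Fin (d + 1)) ℝ A)
    (f : EuclideanSpace ℝ (Fin m) → A) (x : EuclideanSpace ℝ (Fin m)) : A :=
  ∑ s : Fin m, v s.succ * partialDeriv b s f x

/-- `(x₀, x₁, …, x_m) ↦ (x₁, …, x_m)`. -/
def vectorPart (x : EuclideanSpace ℝ (Fin (m + 1))) : EuclideanSpace ℝ (Fin m) :=
  WithLp.toLp 2 fun s => x s.succ

/-- The left Cauchy-Kovalevskaya extension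
`∑ₙ (-x₀)ⁿ / n! · (∑ₛ vₛ ∂ₛ)ⁿ f₀ (x₁, …, x_m)`; the series of elements of the finite-dimensional
space `A` is summed componentwise. It is a finite sum when `f₀` is a polynomial. -/
def CK (v : Fin (m + 1) → A) (b : Module.Basis (Fin (d + 1)) ℝ A)
    (f₀ : EuclideanSpace ℝ (Fin m) → A) (x : EuclideanSpace ℝ (Fin (m + 1))) : A :=
  ∑ t, (∑' n : ℕ, b.coord t
    (((-x 0) ^ n / (n.factorial : ℝ)) • ((vectorCR v b)^[n] f₀) (vectorPart x))) • b t

end Calculus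

/-- The monomial `x₁^{k₁} ⋯ x_m^{k_m}`, as a function with values in `ℝ ⊆ A`. -/
def monomial (A : Type*) [NonAssocRing A] [Module ℝ A] {m : ℕ} (k : Fin m → ℕ)
    (x : EuclideanSpace ℝ (Fin m)) : A :=
  (∏ s, x s ^ k s) • (1 : A)

/-- Associative orders (ways to insert parentheses) for a product of `n` ordered factors.
The empty product is allowed. -/
inductive AssocOrder : ℕ → Type
  | empty : AssocOrder 0
  | single : AssocOrder 1
  | mul {p q : ℕ} (l : AssocOrder p) (r : AssocOrder q) : AssocOrder (p + q)

/-- The product of `x₁, …, xₙ` (in this order) with the given parentheses;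
the empty product is `1`. -/
def AssocOrder.prod {A : Type*} [NonAssocRing A] : {n : ℕ} → AssocOrder n → (Fin n → A) → A
  | _, .empty, _ => 1
  | _, .single, x => x 0
  | _, .mul (p := p) (q := q) l r, x =>
      l.prod (fun i => x (Fin.castAdd q i)) * r.prod (fun i => x (Fin.natAdd p i))

section Fueter

variable {A : Type*} [NonAssocRing A] [Module ℝ A] {m : ℕ}

/-- The Fueter variables `z_ℓ(x) = x_ℓ - x₀ v_ℓ`, `ℓ = 1, …, m`. -/
def fueterVar (v : Fin (m + 1) → A) (l : Fin m) (x : EuclideanSpace ℝ (Fin (m + 1))) : A :=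
  x l.succ • (1 : A) - x 0 • v l.succ

/-- The distinguishable permutations of the word consisting of `k₁` letters `1`, …, `k_m`
letters `m`, i.e. all words of length `|k|` in which each letter `ℓ` occurs `k_ℓ` times. -/
def words (k : Fin m → ℕ) : Finset (Fin (∑ l, k l) → Fin m) :=
  Finset.univ.filter fun i => ∀ l, (Finset.univ.filter fun j => i j = l).card = k l

/-- The Fueter polynomial `P_k = 1/|k|! · ∑ z_{i₁} z_{i₂} ⋯ z_{iₙ}`, summed over the distinguishable
permutations `(i₁, …, iₙ)`, with all products formed in the associative order `τ`. -/
def fueterPoly (v : Fin (m + 1) → A) (k : Fin m → ℕ) (τ : AssocOrder (∑ l, k l))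
    (x : EuclideanSpace ℝ (Fin (m + 1))) : A :=
  ((∑ l, k l).factorial : ℝ)⁻¹ • ∑ i ∈ words k, τ.prod fun j => fueterVar v (i j) x

end Fueter

end Hypercomplex

end

/-! The proof is by generating functions. For real `c`, put `w = ∑ c_l v_l`. The basis relations
give `w * w = -|c|²`, so the span of `1` and `w` is the image of a commutative associative quadratic
algebra under a multiplicative map, and it lies in `M`. The combination `Z = ∑ c_l z_l = ⟨c, x⟩ - x₀
w` belongs to this span, so `Z ^ n` is the same for every placement of parentheses. By
multilinearity it expands as `∑ c^k W_k` over `|k| = n`, where `W_k` is the sum over the words of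
type `k` (`sum_smul_wordSum`).

Any real-linear assertion about all the `W_k` with `|k| = n` can therefore be tested on `Z ^ n` and
recovered by comparing coefficients in `c`. `Z ^ n` has values in `M`. Its partial derivatives are
`n Z^(n-1)` times `-w` or `c_l`, so in either Cauchy-Riemann operator the `x₀` term cancels the
others.

For `CK`, the multinomial theorem makes `⟨c, y⟩ ^ n` the generating function of the monomials.
Applying the vector operator `j` times yields `n(n-1)⋯(n-j+1) ⟨c, y⟩^(n-j) w^j`, so the terms with
`j > n` vanish and the rest sum to `Z ^ n` by the binomial theorem (`sum_smul_CK_monomial`).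
Comparing coefficients gives `multinomial(k) • CK = W_k`. -/

noncomputable section

namespace Hypercomplex

open scoped ContDiff

/-! ### Comparing coefficients of vector-valued polynomials -/

section CoefficientExtraction

variable {m : ℕ} {E : Type*} [AddCommGroup E] [Module ℝ E]

/-- A polynomial with vector coefficients that vanishes identically has zero coefficients. -/
lemma coeff_eq_zero_of_sum_prod_pow_smul_eq_zero (S : Finset (Fin m → ℕ)) (a : (Fin m → ℕ) → E)
    (h : ∀ c : Fin m → ℝ, ∑ k ∈ S, (∏ l, c l ^ k l) • a k = 0) {k : Fin m → ℕ} (hk : k ∈ S) :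
    a k = 0 := by
  -- Linear functionals separate points, which reduces the claim to real polynomials.
  rw [← Module.forall_dual_apply_eq_zero_iff ℝ]
  intro φ
  have hp : ∑ j ∈ S, MvPolynomial.monomial (Finsupp.equivFunOnFinite.symm j) (φ (a j)) = 0 := by
    refine MvPolynomial.funext fun c => ?_
    have := congrArg φ (h c)
    simp only [map_sum, map_smul, smul_eq_mul, map_zero] at this
    rw [map_sum, map_zero, ← this]
    refine Finset.sum_congr rfl fun j _ => ?_
    rw [MvPolynomial.eval_monomial, mul_comm, Finsupp.prod_fintype _ _ (by simp)]
    rfl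
  have := congrArg (MvPolynomial.coeff (Finsupp.equivFunOnFinite.symm k)) hp
  simpa [MvPolynomial.coeff_sum, MvPolynomial.coeff_monomial, hk] using this

/-- Polynomials with vector coefficients that agree as functions have the same coefficients. -/
lemma coeff_eq_of_sum_prod_pow_smul_eq (S : Finset (Fin m → ℕ)) (a a' : (Fin m → ℕ) → E)
    (h : ∀ c : Fin m → ℝ,
      ∑ k ∈ S, (∏ l, c l ^ k l) • a k = ∑ k ∈ S, (∏ l, c l ^ k l) • a' k)
    {k : Fin m → ℕ} (hk : k ∈ S) : a k = a' k := by
  refine sub_eq_zero.1 (coeff_eq_zero_of_sum_prod_pow_smul_eq_zero S (fun k => a k - a' k)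
    (fun c => ?_) hk)
  simp only [smul_sub, Finset.sum_sub_distrib, h c, sub_self]

/-- A polynomial with values in a subspace has its coefficients in that subspace. -/
lemma coeff_mem_of_sum_prod_pow_smul_mem (N : Submodule ℝ E) (S : Finset (Fin m → ℕ))
    (a : (Fin m → ℕ) → E) (h : ∀ c : Fin m → ℝ, ∑ k ∈ S, (∏ l, c l ^ k l) • a k ∈ N)
    {k : Fin m → ℕ} (hk : k ∈ S) : a k ∈ N := by
  -- Membership in `N` is vanishing in the quotient by `N`.
  rw [← Submodule.Quotient.mk_eq_zero, ← Submodule.mkQ_apply]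
  refine coeff_eq_zero_of_sum_prod_pow_smul_eq_zero S (fun k => N.mkQ (a k)) (fun c => ?_) hk
  have := (Submodule.Quotient.mk_eq_zero N).2 (h c)
  rw [← Submodule.mkQ_apply, map_sum] at this
  simpa only [map_smul] using this

end CoefficientExtraction

/-! ### Expanding a parenthesized power over words -/

section Words

variable {A : Type*} [NonAssocRing A] [Module ℝ A] {m n : ℕ}

/-- The sum of the products of `z` over all words in which the letter `l` occurs `k l` times. -/
def wordSum (τ : AssocOrder n) (z : Fin m → A) (k : Fin m → ℕ) : A :=
  ∑ i ∈ Finset.univ.filter (fun i : Fin n → Fin m =>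
    ∀ l, (Finset.univ.filter fun j => i j = l).card = k l), τ.prod fun j => z (i j)

lemma fueterPoly_eq_wordSum (v : Fin (m + 1) → A) (k : Fin m → ℕ) (τ : AssocOrder (∑ l, k l))
    (x : EuclideanSpace ℝ (Fin (m + 1))) :
    fueterPoly v k τ x =
      ((∑ l, k l).factorial : ℝ)⁻¹ • wordSum τ (fun l => fueterVar v l x) k := rfl

variable [IsScalarTower ℝ A A] [SMulCommClass ℝ A A]

/-- A parenthesized product is multilinear. -/
lemma AssocOrder.prod_sum_smul {n : ℕ} (τ : AssocOrder n) (c : Fin m → ℝ) (z : Fin m → A) :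
    τ.prod (fun _ => ∑ l, c l • z l) =
      ∑ i : Fin n → Fin m, (∏ j, c (i j)) • τ.prod fun j => z (i j) := by
  induction τ with
  | empty => simp [AssocOrder.prod]
  | single =>
    simp only [AssocOrder.prod]
    rw [← (Equiv.funUnique (Fin 1) (Fin m)).symm.sum_comp]
    simp
  | @mul p q l r ihl ihr =>
    simp only [AssocOrder.prod]
    rw [ihl, ihr, Finset.sum_mul_sum, ← Finset.sum_product', Finset.univ_product_univ,
      ← (Fin.appendEquiv p q).sum_comp]
    refine Finset.sum_congr rfl fun i _ => ?_
    simp [Fin.appendEquiv, Fin.prod_univ_add, smul_mul_smul_comm]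

/-- The scalar attached to a word depends only on its letter counts, so the multilinear expansion
can be grouped by them. -/
lemma AssocOrder.prod_sum_smul_eq_sum_wordSum (τ : AssocOrder n) (c : Fin m → ℝ)
    (z : Fin m → A) :
    τ.prod (fun _ => ∑ l, c l • z l) =
      ∑ k ∈ Finset.univ.piAntidiag n, (∏ l, c l ^ k l) • wordSum τ z k := by
  classical
  rw [AssocOrder.prod_sum_smul, ← Finset.sum_fiberwise_of_maps_to
    (t := Finset.univ.piAntidiag n)
    (g := fun (i : Fin n → Fin m) l => (Finset.univ.filter fun j => i j = l).card)]
  · refine Finset.sum_congr rfl fun k _ => ?_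
    rw [wordSum, Finset.smul_sum]
    refine Finset.sum_congr (by ext i; simp [funext_iff]) fun i hi => ?_
    congr 1
    rw [← Finset.prod_fiberwise' Finset.univ i c]
    refine Finset.prod_congr rfl fun l _ => ?_
    rw [Finset.prod_const, ← (Finset.mem_filter.1 hi).2]
  · intro i _
    rw [Finset.mem_piAntidiag]
    refine ⟨?_, fun _ _ => Finset.mem_univ _⟩
    rw [← Finset.card_eq_sum_card_fiberwise (fun _ _ => Finset.mem_univ _)]
    simp

end Words

/-! ### The commutative associative algebra generated by `w` -/

section QuadraticSubalgebra

variable {A : Type*} [NonAssocRing A] [Module ℝ A]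

/-- The linear map `α + β ω ↦ α + β w` from a quadratic algebra. -/
def quadMap (q : ℝ) (w : A) : QuadraticAlgebra ℝ q 0 →ₗ[ℝ] A where
  toFun z := z.re • (1 : A) + z.im • w
  map_add' y z := by simp only [QuadraticAlgebra.re_add, QuadraticAlgebra.im_add]; module
  map_smul' c z := by
    simp only [QuadraticAlgebra.re_smul, QuadraticAlgebra.im_smul, RingHom.id_apply, smul_eq_mul]
    module

lemma quadMap_apply {q : ℝ} {w : A} (z : QuadraticAlgebra ℝ q 0) :
    quadMap q w z = z.re • (1 : A) + z.im • w := rfl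

lemma quadMap_one {q : ℝ} {w : A} : quadMap q w 1 = 1 := by
  simp [quadMap_apply, QuadraticAlgebra.re_one, QuadraticAlgebra.im_one]

variable [IsScalarTower ℝ A A] [SMulCommClass ℝ A A]

lemma quadMap_mul {q : ℝ} {w : A} (hw : w * w = q • 1) (y z : QuadraticAlgebra ℝ q 0) :
    quadMap q w (y * z) = quadMap q w y * quadMap q w z := by
  simp only [quadMap_apply, QuadraticAlgebra.re_mul, QuadraticAlgebra.im_mul, mul_add, add_mul,
    smul_mul_assoc, mul_smul_comm, one_mul, mul_one, hw]
  module

/-- In the commutative associative algebra generated by an element with real square, the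
placement of parentheses in a power is irrelevant. -/
lemma AssocOrder.prod_quadMap {n : ℕ} (τ : AssocOrder n) {q : ℝ} {w : A} (hw : w * w = q • 1)
    (z : QuadraticAlgebra ℝ q 0) : τ.prod (fun _ => quadMap q w z) = quadMap q w (z ^ n) := by
  induction τ with
  | empty => simp [AssocOrder.prod, quadMap_one]
  | single => simp [AssocOrder.prod]
  | mul l r ihl ihr => simp only [AssocOrder.prod, ihl, ihr, pow_add, quadMap_mul hw]

end QuadraticSubalgebra

/-! ### Squares of imaginary vectors in a hypercomplex basis -/

section Basis

lemma mul_self_of_mem_imagUnits {A : Type*} [NonAssocRing A] [StarRing A] {x : A}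
    (hx : x ∈ imagUnits A) : x * x = -1 := by
  have h : star x = -x := by rw [eq_neg_iff_add_eq_zero, add_comm]; exact hx.1
  have := hx.2
  rw [h, mul_neg] at this
  rw [← this, neg_neg]

variable {A : Type*} [NonAssocRing A] [StarRing A] [Module ℝ A] {M : Submodule ℝ A} {m : ℕ}
  {v : Fin (m + 1) → A}

/-- Anticommutation kills the cross terms, and each `v_l` squares to `-1`. -/
lemma IsHypercomplexBasis.sum_smul_mul_self [IsScalarTower ℝ A A] [SMulCommClass ℝ A A]
    (hv : IsHypercomplexBasis M v) (c : Fin m → ℝ) :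
    (∑ l, c l • v l.succ) * (∑ l, c l • v l.succ) = (-∑ l, c l ^ 2) • (1 : A) := by
  classical
  have hvv (s t : Fin m) : v s.succ * v t.succ + v t.succ * v s.succ =
      if s = t then (-2 : ℝ) • (1 : A) else 0 := by
    split_ifs with h
    · subst h
      rw [mul_self_of_mem_imagUnits (hv.mem_imagUnits s)]
      module
    · rw [hv.anticomm s t h, neg_add_cancel]
  -- Doubling lets the double sum be symmetrized, so that only anticommutators occur.
  have h2 : (2 : ℝ) • ((∑ l, c l • v l.succ) * (∑ l, c l • v l.succ)) =
      (2 : ℝ) • ((-∑ l, c l ^ 2) • (1 : A)) := by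
    rw [two_smul, Finset.sum_mul_sum]
    nth_rw 2 [Finset.sum_comm]
    simp_rw [← Finset.sum_add_distrib, smul_mul_smul_comm]
    have : ∀ s t, (c s * c t) • (v s.succ * v t.succ) + (c t * c s) • (v t.succ * v s.succ) =
        if s = t then (-2 * c s ^ 2) • (1 : A) else 0 := by
      intro s t
      rw [mul_comm (c t), ← smul_add, hvv]
      split_ifs with h
      · subst h; module
      · simp
    simp only [this, Finset.sum_ite_eq, Finset.mem_univ, if_true]
    rw [← Finset.sum_smul, ← Finset.mul_sum, smul_smul]
    congr 1; ring
  exact smul_right_injective A (two_ne_zero (α := ℝ)) h2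

lemma IsHypercomplexBasis.mem (hv : IsHypercomplexBasis M v) (s : Fin (m + 1)) : v s ∈ M :=
  hv.span_eq ▸ Submodule.subset_span ⟨s, rfl⟩

/-- This is why powers of `Z` stay in `M`, although `M` is not assumed closed under products. -/
lemma IsHypercomplexBasis.quadMap_mem (hv : IsHypercomplexBasis M v) (c : Fin m → ℝ) {q : ℝ}
    (z : QuadraticAlgebra ℝ q 0) : quadMap q (∑ l, c l • v l.succ) z ∈ M :=
  M.add_mem (M.smul_mem _ (hv.zero_eq_one ▸ hv.mem 0))
    (M.smul_mem _ (M.sum_mem fun l _ => M.smul_mem _ (hv.mem l.succ)))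

end Basis

/-! ### Componentwise calculus -/

section Smooth

variable {A : Type*} [NonAssocRing A] [Module ℝ A] {n m d : ℕ}
  {b : Module.Basis (Fin (d + 1)) ℝ A} {ι : Type*}

/-- Functions all of whose real components are smooth. -/
def IsSmooth (b : Module.Basis (Fin (d + 1)) ℝ A) (f : EuclideanSpace ℝ (Fin n) → A) : Prop :=
  ∀ t, ContDiff ℝ ∞ fun x => b.coord t (f x)

/-- `f'` is the derivative of `f` at `x` in the direction of the `s`-th coordinate, taken
componentwise. -/
def HasPartialDeriv (b : Module.Basis (Fin (d + 1)) ℝ A) (s : Fin n)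
    (f : EuclideanSpace ℝ (Fin n) → A) (f' : A) (x : EuclideanSpace ℝ (Fin n)) : Prop :=
  ∀ t, HasLineDerivAt ℝ (fun y => b.coord t (f y)) (b.coord t f') x
    (EuclideanSpace.single s (1 : ℝ))

lemma sum_coord_smul (b : Module.Basis (Fin (d + 1)) ℝ A) (a : A) :
    ∑ t, b.coord t a • b t = a := by
  simp [b.sum_repr a]

/-- Structure constants reduce smoothness of products and the Leibniz rule to real functions. -/
lemma coord_mul [IsScalarTower ℝ A A] [SMulCommClass ℝ A A] (t : Fin (d + 1)) (a a' : A) :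
    b.coord t (a * a') =
      ∑ i, ∑ j, b.coord i a * b.coord j a' * b.coord t (b i * b j) := by
  conv_lhs => rw [← sum_coord_smul b a, ← sum_coord_smul b a']
  rw [Finset.sum_mul_sum]
  simp only [map_sum, smul_mul_smul_comm, map_smul, smul_eq_mul]

lemma IsSmooth.isC1On {f : EuclideanSpace ℝ (Fin n) → A} (hf : IsSmooth b f)
    (Ω : Set (EuclideanSpace ℝ (Fin n))) : IsC1On b Ω f :=
  fun t => ((hf t).of_le (by exact_mod_cast le_top)).contDiffOn

lemma IsSmooth.const_smul {f : EuclideanSpace ℝ (Fin n) → A} (hf : IsSmooth b f) (c : ℝ) :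
    IsSmooth b fun x => c • f x := by
  intro t
  simp only [map_smul, smul_eq_mul]
  exact contDiff_const.mul (hf t)

lemma isSmooth_smul_const {g : EuclideanSpace ℝ (Fin n) → ℝ} (hg : ContDiff ℝ ∞ g) (a : A) :
    IsSmooth b fun x => g x • a := by
  intro t
  simp only [map_smul, smul_eq_mul]
  exact hg.mul contDiff_const

lemma isSmooth_const (a : A) : IsSmooth b fun _ : EuclideanSpace ℝ (Fin n) => a :=
  fun _ => contDiff_const

lemma IsSmooth.sub {f g : EuclideanSpace ℝ (Fin n) → A} (hf : IsSmooth b f)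
    (hg : IsSmooth b g) : IsSmooth b fun x => f x - g x := by
  intro t
  simp only [map_sub]
  exact (hf t).sub (hg t)

lemma IsSmooth.sum {S : Finset ι} {f : ι → EuclideanSpace ℝ (Fin n) → A}
    (hf : ∀ i ∈ S, IsSmooth b (f i)) : IsSmooth b fun x => ∑ i ∈ S, f i x := by
  intro t
  simp only [map_sum]
  exact ContDiff.sum fun i hi => hf i hi t

lemma IsSmooth.mul [IsScalarTower ℝ A A] [SMulCommClass ℝ A A]
    {f g : EuclideanSpace ℝ (Fin n) → A} (hf : IsSmooth b f) (hg : IsSmooth b g) :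
    IsSmooth b fun x => f x * g x := by
  intro t
  rw [funext fun x => coord_mul t (f x) (g x)]
  exact ContDiff.sum fun i _ => ContDiff.sum fun j _ => ((hf i).mul (hg j)).mul contDiff_const

lemma IsSmooth.assocOrderProd [IsScalarTower ℝ A A] [SMulCommClass ℝ A A] {p : ℕ}
    (τ : AssocOrder p) {f : Fin p → EuclideanSpace ℝ (Fin n) → A} (hf : ∀ i, IsSmooth b (f i)) :
    IsSmooth b fun x => τ.prod fun i => f i x := by
  induction τ with
  | empty => exact isSmooth_const _
  | single => exact hf 0
  | mul l r ihl ihr => exact (ihl fun i => hf _).mul (ihr fun i => hf _)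

lemma coord_partialDeriv (s : Fin n) (f : EuclideanSpace ℝ (Fin n) → A)
    (x : EuclideanSpace ℝ (Fin n)) (t : Fin (d + 1)) :
    b.coord t (partialDeriv b s f x) =
      lineDeriv ℝ (fun y => b.coord t (f y)) x (EuclideanSpace.single s (1 : ℝ)) := by
  simp [partialDeriv, Finsupp.single_apply]

lemma HasPartialDeriv.partialDeriv_eq {s : Fin n} {f : EuclideanSpace ℝ (Fin n) → A} {f' : A}
    {x : EuclideanSpace ℝ (Fin n)} (h : HasPartialDeriv b s f f' x) :
    partialDeriv b s f x = f' := by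
  refine b.ext_elem fun t => ?_
  have := coord_partialDeriv (b := b) s f x t
  rwa [(h t).lineDeriv] at this

lemma IsSmooth.hasPartialDeriv {f : EuclideanSpace ℝ (Fin n) → A} (hf : IsSmooth b f)
    (s : Fin n) (x : EuclideanSpace ℝ (Fin n)) :
    HasPartialDeriv b s f (partialDeriv b s f x) x := by
  intro t
  rw [coord_partialDeriv]
  exact ((hf t).differentiable (by simp) x).lineDifferentiableAt.hasLineDerivAt

lemma IsSmooth.partialDeriv {f : EuclideanSpace ℝ (Fin n) → A} (hf : IsSmooth b f)
    (s : Fin n) : IsSmooth b (partialDeriv b s f) := by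
  intro t
  simp only [coord_partialDeriv]
  have : (fun x => lineDeriv ℝ (fun y => b.coord t (f y)) x (EuclideanSpace.single s (1 : ℝ))) =
      fun x => fderiv ℝ (fun y => b.coord t (f y)) x (EuclideanSpace.single s (1 : ℝ)) := by
    funext x
    exact ((hf t).differentiable (by simp) x).lineDeriv_eq_fderiv
  rw [this]
  exact ((hf t).fderiv_right (m := ∞) (by simp)).clm_apply contDiff_const

lemma HasPartialDeriv.sum_smul {s : Fin n} {S : Finset ι} {c : ι → ℝ}
    {f : ι → EuclideanSpace ℝ (Fin n) → A} {f' : ι → A} {x : EuclideanSpace ℝ (Fin n)}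
    (h : ∀ i ∈ S, HasPartialDeriv b s (f i) (f' i) x) :
    HasPartialDeriv b s (fun y => ∑ i ∈ S, c i • f i y) (∑ i ∈ S, c i • f' i) x := by
  intro t
  simp only [map_sum, map_smul, smul_eq_mul]
  exact HasDerivAt.fun_sum fun i hi => HasDerivAt.const_mul (c i) (h i hi t)

lemma HasPartialDeriv.mul [IsScalarTower ℝ A A] [SMulCommClass ℝ A A] {s : Fin n}
    {f g : EuclideanSpace ℝ (Fin n) → A} {f' g' : A} {x : EuclideanSpace ℝ (Fin n)}
    (hf : HasPartialDeriv b s f f' x) (hg : HasPartialDeriv b s g g' x) :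
    HasPartialDeriv b s (fun y => f y * g y) (f' * g x + f x * g') x := by
  intro t
  rw [funext fun y => coord_mul t (f y) (g y), map_add, coord_mul t f', coord_mul t (f x)]
  simp only [← Finset.sum_add_distrib, ← add_mul]
  refine HasDerivAt.fun_sum fun i _ => HasDerivAt.fun_sum fun j _ => ?_
  have := (HasDerivAt.mul (hf i) (hg j)).mul_const (b.coord t (b i * b j))
  simpa using this

lemma hasPartialDeriv_smul_const {s : Fin n} {g : EuclideanSpace ℝ (Fin n) → ℝ} {g' : ℝ}
    {x : EuclideanSpace ℝ (Fin n)}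
    (hg : HasLineDerivAt ℝ g g' x (EuclideanSpace.single s (1 : ℝ))) (a : A) :
    HasPartialDeriv b s (fun y => g y • a) (g' • a) x := by
  intro t
  simp only [map_smul, smul_eq_mul]
  exact HasDerivAt.mul_const hg _

lemma hasPartialDeriv_const (s : Fin n) (x : EuclideanSpace ℝ (Fin n)) (a : A) :
    HasPartialDeriv b s (fun _ => a) 0 x := by
  intro t
  rw [map_zero]
  exact hasDerivAt_const _ _

lemma partialDeriv_sum_smul {s : Fin n} {S : Finset ι} {c : ι → ℝ}
    {f : ι → EuclideanSpace ℝ (Fin n) → A} (hf : ∀ i ∈ S, IsSmooth b (f i))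
    (x : EuclideanSpace ℝ (Fin n)) :
    partialDeriv b s (fun y => ∑ i ∈ S, c i • f i y) x =
      ∑ i ∈ S, c i • partialDeriv b s (f i) x :=
  (HasPartialDeriv.sum_smul fun i hi => (hf i hi).hasPartialDeriv s x).partialDeriv_eq

end Smooth

/-! ### Linearity of the Cauchy-Riemann operators -/

section Operators

variable {A : Type*} [NonAssocRing A] [Module ℝ A]
  {m d : ℕ} {b : Module.Basis (Fin (d + 1)) ℝ A} {ι : Type*} {v : Fin (m + 1) → A}

lemma leftCR_sum_smul [SMulCommClass ℝ A A] {S : Finset ι} {c : ι → ℝ}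
    {f : ι → EuclideanSpace ℝ (Fin (m + 1)) → A} (hf : ∀ i ∈ S, IsSmooth b (f i))
    (x : EuclideanSpace ℝ (Fin (m + 1))) :
    leftCR v b (fun y => ∑ i ∈ S, c i • f i y) x = ∑ i ∈ S, c i • leftCR v b (f i) x := by
  simp only [leftCR, partialDeriv_sum_smul hf, Finset.mul_sum, Finset.smul_sum, mul_smul_comm]
  exact Finset.sum_comm

lemma rightCR_sum_smul [IsScalarTower ℝ A A] {S : Finset ι} {c : ι → ℝ}
    {f : ι → EuclideanSpace ℝ (Fin (m + 1)) → A} (hf : ∀ i ∈ S, IsSmooth b (f i))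
    (x : EuclideanSpace ℝ (Fin (m + 1))) :
    rightCR v b (fun y => ∑ i ∈ S, c i • f i y) x = ∑ i ∈ S, c i • rightCR v b (f i) x := by
  simp only [rightCR, partialDeriv_sum_smul hf, Finset.sum_mul, Finset.smul_sum, smul_mul_assoc]
  exact Finset.sum_comm

lemma vectorCR_sum_smul [SMulCommClass ℝ A A] {S : Finset ι} {c : ι → ℝ}
    {f : ι → EuclideanSpace ℝ (Fin m) → A} (hf : ∀ i ∈ S, IsSmooth b (f i)) :
    vectorCR v b (fun y => ∑ i ∈ S, c i • f i y) =
      fun x => ∑ i ∈ S, c i • vectorCR v b (f i) x := by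
  funext x
  simp only [vectorCR, partialDeriv_sum_smul hf, Finset.mul_sum, Finset.smul_sum, mul_smul_comm]
  exact Finset.sum_comm

variable [IsScalarTower ℝ A A] [SMulCommClass ℝ A A]

lemma IsSmooth.vectorCR {f : EuclideanSpace ℝ (Fin m) → A} (hf : IsSmooth b f) :
    IsSmooth b (vectorCR v b f) :=
  IsSmooth.sum fun s _ => (isSmooth_const _).mul (hf.partialDeriv s)

lemma IsSmooth.iterate_vectorCR {f : EuclideanSpace ℝ (Fin m) → A} (hf : IsSmooth b f) (j : ℕ) :
    IsSmooth b ((Hypercomplex.vectorCR v b)^[j] f) := by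
  induction j with
  | zero => exact hf
  | succ j ih => rw [Function.iterate_succ_apply']; exact ih.vectorCR

lemma iterate_vectorCR_sum_smul {S : Finset ι} {c : ι → ℝ}
    {f : ι → EuclideanSpace ℝ (Fin m) → A} (hf : ∀ i ∈ S, IsSmooth b (f i)) (j : ℕ) :
    (vectorCR v b)^[j] (fun y => ∑ i ∈ S, c i • f i y) =
      fun x => ∑ i ∈ S, c i • (vectorCR v b)^[j] (f i) x := by
  induction j with
  | zero => rfl
  | succ j ih =>
    simp only [Function.iterate_succ_apply', ih]
    exact vectorCR_sum_smul fun i hi => (hf i hi).iterate_vectorCR j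

end Operators

/-! ### Derivatives of the generating functions -/

section GeneratingFunctions

variable {A : Type*} [NonAssocRing A] [Module ℝ A]
  {m d : ℕ} {b : Module.Basis (Fin (d + 1)) ℝ A} {v : Fin (m + 1) → A}

/-- The element `∑ cₗ xₗ - x₀ ω` of a quadratic algebra. -/
def genVar (q : ℝ) (c : Fin m → ℝ) (x : EuclideanSpace ℝ (Fin (m + 1))) :
    QuadraticAlgebra ℝ q 0 :=
  ⟨∑ l, c l * x l.succ, -x 0⟩

lemma genVar_single_zero (q : ℝ) (c : Fin m → ℝ) :
    genVar q c (EuclideanSpace.single 0 1) = -⟨0, 1⟩ := by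
  ext <;> simp [genVar, Fin.succ_ne_zero]

lemma genVar_single_succ (q : ℝ) (c : Fin m → ℝ) (l : Fin m) :
    genVar q c (EuclideanSpace.single l.succ 1) = c l • 1 := by
  ext <;> simp [genVar, QuadraticAlgebra.re_one, QuadraticAlgebra.im_one,
    (Fin.succ_ne_zero _).symm]

lemma sum_smul_fueterVar (q : ℝ) (c : Fin m → ℝ) (x : EuclideanSpace ℝ (Fin (m + 1))) :
    ∑ l, c l • fueterVar v l x = quadMap q (∑ l, c l • v l.succ) (genVar q c x) := by
  simp only [fueterVar, quadMap_apply, genVar, Finset.smul_sum, Finset.sum_smul,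
    ← Finset.sum_add_distrib]
  exact Finset.sum_congr rfl fun l _ => by module

/-- `genVar` is linear in `x`, so its derivative along `e_s` is its value at `e_s`. -/
lemma hasPartialDeriv_quadMap_genVar (q : ℝ) (w : A) (c : Fin m → ℝ) (s : Fin (m + 1))
    (x : EuclideanSpace ℝ (Fin (m + 1))) :
    HasPartialDeriv b s (fun y => quadMap q w (genVar q c y))
      (quadMap q w (genVar q c (EuclideanSpace.single s 1))) x := by
  intro t
  have hlin : ∀ r : ℝ, b.coord t (quadMap q w (genVar q c (x + r • EuclideanSpace.single s 1))) =
      b.coord t (quadMap q w (genVar q c x)) +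
        r * b.coord t (quadMap q w (genVar q c (EuclideanSpace.single s 1))) := by
    intro r
    have : genVar q c (x + r • EuclideanSpace.single s 1) =
        genVar q c x + r • genVar q c (EuclideanSpace.single s 1) := by
      ext
      · simp only [genVar, QuadraticAlgebra.re_add, QuadraticAlgebra.re_smul, PiLp.add_apply,
          PiLp.smul_apply, smul_eq_mul, Finset.mul_sum, ← Finset.sum_add_distrib]
        exact Finset.sum_congr rfl fun l _ => by ring
      · simp only [genVar, QuadraticAlgebra.im_add, QuadraticAlgebra.im_smul, PiLp.add_apply,
          PiLp.smul_apply, smul_eq_mul]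
        ring
    rw [this, map_add, map_smul, map_add, map_smul, smul_eq_mul]
  rw [HasLineDerivAt, funext hlin]
  have := ((hasDerivAt_id (0 : ℝ)).mul_const
    (b.coord t (quadMap q w (genVar q c (EuclideanSpace.single s 1))))).const_add
    (b.coord t (quadMap q w (genVar q c x)))
  rwa [one_mul] at this

variable [IsScalarTower ℝ A A] [SMulCommClass ℝ A A]

lemma hasPartialDeriv_quadMap_genVar_pow {q : ℝ} {w : A} (hw : w * w = q • 1) (c : Fin m → ℝ)
    (s : Fin (m + 1)) (n : ℕ) (x : EuclideanSpace ℝ (Fin (m + 1))) :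
    HasPartialDeriv b s (fun y => quadMap q w (genVar q c y ^ n))
      (quadMap q w (n * genVar q c x ^ (n - 1) * genVar q c (EuclideanSpace.single s 1))) x := by
  induction n with
  | zero => simpa using hasPartialDeriv_const s x _
  | succ n ih =>
    have := (hasPartialDeriv_quadMap_genVar q w c s x).mul ih
    -- The Leibniz rule is pulled back to the quadratic algebra, where `ring` applies.
    simp only [← quadMap_mul hw, ← map_add, ← pow_succ'] at this
    convert this using 2
    cases n with
    | zero => simp
    | succ n => simp only [Nat.add_sub_cancel]; push_cast; ring

/-- The `x₀` derivative contributes `-w * n Z^(n-1)`; the others, weighted by `v_l`, add up to `w *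
n Z^(n-1)`. -/
lemma leftCR_quadMap_genVar_pow (hv0 : v 0 = 1) {q : ℝ} {c : Fin m → ℝ}
    (hw : (∑ l, c l • v l.succ) * (∑ l, c l • v l.succ) = q • 1) (n : ℕ)
    (x : EuclideanSpace ℝ (Fin (m + 1))) :
    leftCR v b (fun y => quadMap q (∑ l, c l • v l.succ) (genVar q c y ^ n)) x = 0 := by
  have hw1 : quadMap q (∑ l, c l • v l.succ) ⟨0, 1⟩ = ∑ l, c l • v l.succ := by
    simp [quadMap_apply]
  simp only [leftCR, (hasPartialDeriv_quadMap_genVar_pow hw c _ n x).partialDeriv_eq]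
  rw [Fin.sum_univ_succ]
  simp only [hv0, one_mul, genVar_single_zero, genVar_single_succ, mul_smul_comm, mul_one,
    map_smul, mul_neg, map_neg]
  simp only [← smul_mul_assoc _ (v _)]
  -- `mul_comm` acts inside the quadratic algebra, moving the generator to the left.
  rw [← Finset.sum_mul, mul_comm, quadMap_mul hw, hw1, neg_add_cancel]

lemma rightCR_quadMap_genVar_pow (hv0 : v 0 = 1) {q : ℝ} {c : Fin m → ℝ}
    (hw : (∑ l, c l • v l.succ) * (∑ l, c l • v l.succ) = q • 1) (n : ℕ)
    (x : EuclideanSpace ℝ (Fin (m + 1))) :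
    rightCR v b (fun y => quadMap q (∑ l, c l • v l.succ) (genVar q c y ^ n)) x = 0 := by
  have hw1 : quadMap q (∑ l, c l • v l.succ) ⟨0, 1⟩ = ∑ l, c l • v l.succ := by
    simp [quadMap_apply]
  simp only [rightCR, (hasPartialDeriv_quadMap_genVar_pow hw c _ n x).partialDeriv_eq]
  rw [Fin.sum_univ_succ]
  simp only [hv0, genVar_single_zero, genVar_single_succ, mul_smul_comm, mul_one,
    map_smul, mul_neg, map_neg, smul_mul_assoc]
  simp only [← mul_smul_comm]
  rw [← Finset.mul_sum, quadMap_mul hw, hw1, neg_add_cancel]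

lemma vectorCR_pow_smul (c : Fin m → ℝ) (n : ℕ) (a : A) :
    vectorCR v b (fun y => (∑ l, c l * y l) ^ n • a) =
      fun y => (n * (∑ l, c l * y l) ^ (n - 1)) • ((∑ l, c l • v l.succ) * a) := by
  funext x
  have h (s : Fin m) : partialDeriv b s (fun y => (∑ l, c l * y l) ^ n • a) x =
      (n * (∑ l, c l * x l) ^ (n - 1) * c s) • a := by
    refine (hasPartialDeriv_smul_const ?_ a).partialDeriv_eq
    have hlin : ∀ r : ℝ, (∑ l, c l * (x + r • EuclideanSpace.single s (1 : ℝ)) l) ^ n =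
        ((∑ l, c l * x l) + r * c s) ^ n := by
      intro r
      congr 1
      simp [mul_add, Finset.sum_add_distrib, mul_comm r]
    rw [HasLineDerivAt, funext hlin]
    simpa using (((hasDerivAt_id (0 : ℝ)).mul_const (c s)).const_add (∑ l, c l * x l)).fun_pow n
  simp only [vectorCR, h, mul_smul_comm, mul_smul, Finset.sum_mul, Finset.smul_sum,
    smul_mul_assoc]

lemma iterate_vectorCR_pow_smul {q : ℝ} {c : Fin m → ℝ}
    (hw : (∑ l, c l • v l.succ) * (∑ l, c l • v l.succ) = q • 1) (n j : ℕ) :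
    (vectorCR v b)^[j] (fun y => (∑ l, c l * y l) ^ n • (1 : A)) =
      fun y => ((n.descFactorial j : ℝ) * (∑ l, c l * y l) ^ (n - j)) •
        quadMap q (∑ l, c l • v l.succ) (⟨0, 1⟩ ^ j) := by
  induction j with
  | zero => simp [quadMap_one]
  | succ j ih =>
    have hw1 : quadMap q (∑ l, c l • v l.succ) ⟨0, 1⟩ = ∑ l, c l • v l.succ := by
      simp [quadMap_apply]
    rw [Function.iterate_succ_apply', ih]
    simp_rw [mul_comm (n.descFactorial j : ℝ), mul_smul]
    rw [vectorCR_pow_smul]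
    funext y
    have hstep : (∑ l, c l • v l.succ) * quadMap q (∑ l, c l • v l.succ) (⟨0, 1⟩ ^ j) =
        quadMap q (∑ l, c l • v l.succ) (⟨0, 1⟩ ^ (j + 1)) := by
      rw [pow_succ', quadMap_mul hw, hw1]
    rw [mul_smul_comm, hstep, smul_smul, smul_smul, Nat.descFactorial_succ, Nat.sub_sub]
    congr 1
    push_cast
    -- Truncated subtraction does no harm: for `j > n` the falling factorial is zero.
    rcases le_or_gt j n with h | h
    · ring
    · rw [Nat.descFactorial_eq_zero_iff_lt.2 h]; simp

end GeneratingFunctions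

/-! ### The Cauchy-Kovalevskaya extension of monomials -/

section Monomials

variable {A : Type*} [NonAssocRing A] [Module ℝ A]
  {m d : ℕ} {b : Module.Basis (Fin (d + 1)) ℝ A} {v : Fin (m + 1) → A}

lemma isSmooth_monomial (k : Fin m → ℕ) : IsSmooth b (monomial A k) :=
  isSmooth_smul_const (by fun_prop) _

lemma linear_pow_smul_eq_sum_monomial (c : Fin m → ℝ) (n : ℕ) :
    (fun y : EuclideanSpace ℝ (Fin m) => (∑ l, c l * y l) ^ n • (1 : A)) =
      fun y => ∑ k ∈ Finset.univ.piAntidiag n,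
        ((∏ l, c l ^ k l) * Nat.multinomial Finset.univ k) • monomial A k y := by
  funext y
  rw [Finset.sum_pow_eq_sum_piAntidiag, Finset.sum_smul]
  refine Finset.sum_congr rfl fun k _ => ?_
  rw [monomial, smul_smul]
  congr 1
  simp only [mul_pow, Finset.prod_mul_distrib]
  ring

lemma cast_multinomial_ne_zero (k : Fin m → ℕ) :
    (Nat.multinomial Finset.univ k : ℝ) ≠ 0 :=
  Nat.cast_ne_zero.2 (Nat.multinomial_pos _ _).ne'

variable [IsScalarTower ℝ A A] [SMulCommClass ℝ A A]

lemma sum_smul_iterate_vectorCR_monomial {q : ℝ} {c : Fin m → ℝ}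
    (hw : (∑ l, c l • v l.succ) * (∑ l, c l • v l.succ) = q • 1) (n j : ℕ)
    (y : EuclideanSpace ℝ (Fin m)) :
    ∑ k ∈ Finset.univ.piAntidiag n, (∏ l, c l ^ k l) •
        ((Nat.multinomial Finset.univ k : ℝ) • (vectorCR v b)^[j] (monomial A k) y) =
      ((n.descFactorial j : ℝ) * (∑ l, c l * y l) ^ (n - j)) •
        quadMap q (∑ l, c l • v l.succ) (⟨0, 1⟩ ^ j) := by
  have := congrFun (iterate_vectorCR_pow_smul (b := b) hw n j) y
  rw [linear_pow_smul_eq_sum_monomial,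
    iterate_vectorCR_sum_smul fun k _ => isSmooth_monomial k] at this
  simpa only [smul_smul] using this

variable [StarRing A] {M : Submodule ℝ A}

/-- The generating function carries the factor `n.descFactorial j`, which is zero for `j > n`; the
multinomial coefficient can then be cancelled. -/
lemma IsHypercomplexBasis.iterate_vectorCR_monomial_eq_zero (hv : IsHypercomplexBasis M v)
    (k : Fin m → ℕ) {j : ℕ} (hj : ∑ l, k l < j) :
    (vectorCR v b)^[j] (monomial A k) = fun _ => 0 := by
  funext y
  have := coeff_eq_zero_of_sum_prod_pow_smul_eq_zero (Finset.univ.piAntidiag (∑ l, k l))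
    (fun k => (Nat.multinomial Finset.univ k : ℝ) • (vectorCR v b)^[j] (monomial A k) y)
    (fun c => by
      rw [sum_smul_iterate_vectorCR_monomial (hv.sum_smul_mul_self c),
        Nat.descFactorial_eq_zero_iff_lt.2 hj]
      simp) (k := k) (by simp)
  exact (smul_eq_zero.1 this).resolve_left (cast_multinomial_ne_zero k)

lemma IsHypercomplexBasis.CK_monomial_eq_sum (hv : IsHypercomplexBasis M v) {k : Fin m → ℕ}
    {n : ℕ} (hk : ∑ l, k l = n) (x : EuclideanSpace ℝ (Fin (m + 1))) :
    CK v b (monomial A k) x = ∑ j ∈ Finset.range (n + 1),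
      ((-x 0) ^ j / (j.factorial : ℝ)) • (vectorCR v b)^[j] (monomial A k) (vectorPart x) := by
  rw [CK, ← sum_coord_smul b (∑ j ∈ Finset.range (n + 1), _)]
  refine Finset.sum_congr rfl fun t _ => ?_
  rw [map_sum, tsum_eq_sum]
  intro j hj
  rw [hv.iterate_vectorCR_monomial_eq_zero k (by simp at hj; omega)]
  simp

/-- Since `n.descFactorial j / j!` is a binomial coefficient, this is the binomial expansion of
`(-x₀ ω + ⟨c, x⟩) ^ n`, with `ω` the generator mapped to `w`. -/
lemma IsHypercomplexBasis.sum_smul_CK_monomial (hv : IsHypercomplexBasis M v) (c : Fin m → ℝ)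
    (n : ℕ) (x : EuclideanSpace ℝ (Fin (m + 1))) :
    ∑ k ∈ Finset.univ.piAntidiag n, (∏ l, c l ^ k l) •
        ((Nat.multinomial Finset.univ k : ℝ) • CK v b (monomial A k) x) =
      quadMap (-∑ l, c l ^ 2) (∑ l, c l • v l.succ) (genVar _ c x ^ n) := by
  have hw := hv.sum_smul_mul_self c
  set q := -∑ l, c l ^ 2
  have hz : genVar q c x = (-x 0) • ⟨0, 1⟩ + (∑ l, c l * x l.succ) • 1 := by
    ext <;> simp [genVar, QuadraticAlgebra.re_one, QuadraticAlgebra.im_one]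
  calc _ = ∑ k ∈ Finset.univ.piAntidiag n, (∏ l, c l ^ k l) •
        ((Nat.multinomial Finset.univ k : ℝ) • ∑ j ∈ Finset.range (n + 1),
          ((-x 0) ^ j / (j.factorial : ℝ)) •
            (vectorCR v b)^[j] (monomial A k) (vectorPart x)) :=
        Finset.sum_congr rfl fun k hk => by
          rw [hv.CK_monomial_eq_sum (Finset.mem_piAntidiag.1 hk).1]
    _ = ∑ j ∈ Finset.range (n + 1), ((-x 0) ^ j / (j.factorial : ℝ)) •
        ∑ k ∈ Finset.univ.piAntidiag n, (∏ l, c l ^ k l) •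
          ((Nat.multinomial Finset.univ k : ℝ) •
            (vectorCR v b)^[j] (monomial A k) (vectorPart x)) := by
        simp only [Finset.smul_sum]
        rw [Finset.sum_comm]
        refine Finset.sum_congr rfl fun j _ => Finset.sum_congr rfl fun k _ => ?_
        simp only [smul_smul]
        congr 1; ring
    _ = _ := by
        rw [hz, add_pow, map_sum]
        refine Finset.sum_congr rfl fun j _ => ?_
        rw [sum_smul_iterate_vectorCR_monomial hw, smul_pow, smul_pow, one_pow, mul_smul_comm,
          mul_one, ← nsmul_eq_mul', ← Nat.cast_smul_eq_nsmul ℝ]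
        simp only [map_smul, smul_smul]
        rw [Nat.descFactorial_eq_factorial_mul_choose]
        congr 1
        have : (j.factorial : ℝ) ≠ 0 := Nat.cast_ne_zero.2 j.factorial_ne_zero
        simp only [vectorPart]
        push_cast
        field_simp

end Monomials

/-! ### Fueter polynomials as coefficients of `Z ^ n` -/

section FueterPolynomials

variable {A : Type*} [NonAssocRing A] [Module ℝ A] [IsScalarTower ℝ A A] [SMulCommClass ℝ A A]
  {m d n : ℕ} {b : Module.Basis (Fin (d + 1)) ℝ A} {v : Fin (m + 1) → A}

lemma isSmooth_wordSum (τ : AssocOrder n) (k : Fin m → ℕ) :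
    IsSmooth b fun x => wordSum τ (fun l => fueterVar v l x) k :=
  IsSmooth.sum fun _ _ => IsSmooth.assocOrderProd τ fun _ =>
    (isSmooth_smul_const (by fun_prop) _).sub (isSmooth_smul_const (by fun_prop) _)

variable [StarRing A] {M : Submodule ℝ A}

lemma IsHypercomplexBasis.sum_smul_wordSum (hv : IsHypercomplexBasis M v) (τ : AssocOrder n)
    (c : Fin m → ℝ) (x : EuclideanSpace ℝ (Fin (m + 1))) :
    ∑ k ∈ Finset.univ.piAntidiag n,
        (∏ l, c l ^ k l) • wordSum τ (fun l => fueterVar v l x) k =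
      quadMap (-∑ l, c l ^ 2) (∑ l, c l • v l.succ) (genVar _ c x ^ n) := by
  rw [← AssocOrder.prod_sum_smul_eq_sum_wordSum, ← τ.prod_quadMap (hv.sum_smul_mul_self c),
    sum_smul_fueterVar]

lemma IsHypercomplexBasis.wordSum_mem (hv : IsHypercomplexBasis M v) (k : Fin m → ℕ)
    (τ : AssocOrder (∑ l, k l)) (x : EuclideanSpace ℝ (Fin (m + 1))) :
    wordSum τ (fun l => fueterVar v l x) k ∈ M :=
  coeff_mem_of_sum_prod_pow_smul_mem M (Finset.univ.piAntidiag (∑ l, k l)) _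
    (fun c => (hv.sum_smul_wordSum τ c x).symm ▸ hv.quadMap_mem c _) (by simp)

lemma IsHypercomplexBasis.leftCR_wordSum (hv : IsHypercomplexBasis M v) (k : Fin m → ℕ)
    (τ : AssocOrder (∑ l, k l)) (x : EuclideanSpace ℝ (Fin (m + 1))) :
    leftCR v b (fun x => wordSum τ (fun l => fueterVar v l x) k) x = 0 := by
  refine coeff_eq_zero_of_sum_prod_pow_smul_eq_zero (Finset.univ.piAntidiag (∑ l, k l))
    (fun k => leftCR v b (fun x => wordSum τ (fun l => fueterVar v l x) k) x) (fun c => ?_)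
    (by simp)
  rw [← leftCR_sum_smul fun k _ => isSmooth_wordSum τ k, funext (hv.sum_smul_wordSum τ c)]
  exact leftCR_quadMap_genVar_pow hv.zero_eq_one (hv.sum_smul_mul_self c) _ x

lemma IsHypercomplexBasis.rightCR_wordSum (hv : IsHypercomplexBasis M v) (k : Fin m → ℕ)
    (τ : AssocOrder (∑ l, k l)) (x : EuclideanSpace ℝ (Fin (m + 1))) :
    rightCR v b (fun x => wordSum τ (fun l => fueterVar v l x) k) x = 0 := by
  refine coeff_eq_zero_of_sum_prod_pow_smul_eq_zero (Finset.univ.piAntidiag (∑ l, k l))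
    (fun k => rightCR v b (fun x => wordSum τ (fun l => fueterVar v l x) k) x) (fun c => ?_)
    (by simp)
  rw [← rightCR_sum_smul fun k _ => isSmooth_wordSum τ k, funext (hv.sum_smul_wordSum τ c)]
  exact rightCR_quadMap_genVar_pow hv.zero_eq_one (hv.sum_smul_mul_self c) _ x

/-- The free factor `r` serves both normalizations, `1 / |k|!` for `fueterPoly` and `k! / |k|!` for
`CK`. -/
lemma IsHypercomplexBasis.smul_wordSum_mem_monogenic (hv : IsHypercomplexBasis M v)
    (k : Fin m → ℕ) (τ : AssocOrder (∑ l, k l)) (r : ℝ) :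
    (fun x => r • wordSum τ (fun l => fueterVar v l x) k) ∈
      leftMonogenic v b Set.univ M ∩ rightMonogenic v b Set.univ M := by
  have hs := isSmooth_wordSum (b := b) (v := v) τ k
  have hM := fun x => M.smul_mem r (hv.wordSum_mem k τ x)
  have hC := (hs.const_smul r).isC1On Set.univ
  refine ⟨⟨fun x _ => hM x, hC, fun x _ => ?_⟩, ⟨fun x _ => hM x, hC, fun x _ => ?_⟩⟩
  -- Homogeneity is the one-term case of linearity.
  · have := leftCR_sum_smul (v := v) (S := {()}) (c := fun _ => r) (fun _ _ => hs) x
    simpa [hv.leftCR_wordSum] using this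
  · have := rightCR_sum_smul (v := v) (S := {()}) (c := fun _ => r) (fun _ _ => hs) x
    simpa [hv.rightCR_wordSum] using this

/-- Both sides have generating function `Z ^ n` up to normalization, and `k!` times the multinomial
coefficient is `|k|!`. -/
lemma IsHypercomplexBasis.CK_monomial (hv : IsHypercomplexBasis M v) (k : Fin m → ℕ)
    (τ : AssocOrder (∑ l, k l)) (x : EuclideanSpace ℝ (Fin (m + 1))) :
    CK v b (monomial A k) x = (∏ l, ((k l).factorial : ℝ)) • fueterPoly v k τ x := by
  have h := coeff_eq_of_sum_prod_pow_smul_eq (Finset.univ.piAntidiag (∑ l, k l))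
    (fun k => (Nat.multinomial Finset.univ k : ℝ) • CK v b (monomial A k) x)
    (fun k => wordSum τ (fun l => fueterVar v l x) k)
    (fun c => (hv.sum_smul_CK_monomial c _ x).trans (hv.sum_smul_wordSum τ c x).symm)
    (k := k) (by simp)
  have hf : (∏ l, ((k l).factorial : ℝ)) * Nat.multinomial Finset.univ k =
      (∑ l, k l).factorial := by
    exact_mod_cast Nat.multinomial_spec Finset.univ k
  rw [fueterPoly_eq_wordSum, ← h, smul_smul, smul_smul, mul_right_comm, hf,
    mul_inv_cancel₀ (Nat.cast_ne_zero.2 (Nat.factorial_ne_zero _)), one_smul]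

end FueterPolynomials

end Hypercomplex

end

theorem mainTheorem12 {A : Type*} [NonAssocRing A] [StarRing A] [Module ℝ A]
    [IsScalarTower ℝ A A] [SMulCommClass ℝ A A] [StarModule ℝ A]
    (hA : Hypercomplex.IsAlternative A)
    {m d : ℕ} (M : Submodule ℝ A) (hM : Hypercomplex.IsHypercomplexSubspace M)
    (v : Fin (m + 1) → A) (hv : Hypercomplex.IsHypercomplexBasis M v)
    (b : Module.Basis (Fin (d + 1)) ℝ A) (hmd : m ≤ d)
    (hb : ∀ s : Fin (m + 1), b (Fin.castLE (Nat.succ_le_succ hmd) s) = v s)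
    (k : Fin m → ℕ) (τ : Hypercomplex.AssocOrder (∑ l, k l)) :
    (∃ N : ℕ, ∀ n ≥ N,
      (Hypercomplex.vectorCR v b)^[n] (Hypercomplex.monomial A k) = fun _ => 0) ∧
    (∀ x, Hypercomplex.CK v b (Hypercomplex.monomial A k) x =
      (∏ l, ((k l).factorial : ℝ)) • Hypercomplex.fueterPoly v k τ x) ∧
    Hypercomplex.CK v b (Hypercomplex.monomial A k) ∈
      Hypercomplex.leftMonogenic v b Set.univ M ∩ Hypercomplex.rightMonogenic v b Set.univ M ∧
    Hypercomplex.fueterPoly v k τ ∈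
      Hypercomplex.leftMonogenic v b Set.univ M ∩ Hypercomplex.rightMonogenic v b Set.univ M := by

  have hCK : Hypercomplex.CK v b (Hypercomplex.monomial A k) =
      fun x => ((∏ l, ((k l).factorial : ℝ)) * ((∑ l, k l).factorial : ℝ)⁻¹) •
        Hypercomplex.wordSum τ (fun l => Hypercomplex.fueterVar v l x) k := by
    funext x
    rw [hv.CK_monomial k τ, Hypercomplex.fueterPoly_eq_wordSum, smul_smul]
  refine ⟨⟨∑ l, k l + 1, fun n hn => hv.iterate_vectorCR_monomial_eq_zero k hn⟩,
    hv.CK_monomial k τ, ?_, hv.smul_wordSum_mem_monogenic k τ _⟩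
  rw [hCK]
  exact hv.smul_wordSum_mem_monogenic k τ _
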